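/- Let $H$ be an infinite-dimensional complex Hilbert space (not necessarily separable), and let $B(H)$ be the ring of all bounded linear operators on $H$. Let $p_1,p_2,p_3,p_4\in\mathbb{C}[X]$ be polynomials of degree $3$. Then for every $B\in B(H)$ there exist $B_1,B_2,B_3,B_4\in B(H)$ such that $$B=B_1+B_2+B_3+B_4\quad\text{and}\quad p_i(B_i)=0\ \text{ for all } i\in\{1,2,3,4\}.$$ -/

import Mathlib

/-!
Write `R` for the algebra of bounded operators on `H`. As `H` is infinite-dimensional, it is the
Hilbert sum of three copies of itself, so `R` is isomorphic to the algebra of `3 × 3` matrices over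
`R`, and the problem may be solved for such a matrix `B`.

A triangular matrix whose diagonal consists of the three roots of `p i`, as scalars, is annihilated
by `p i`. Adding an upper and a lower triangular one, the first two summands produce every
matrix whose diagonal is one prescribed triple of scalars. It remains to find a sum `S` of two
operators annihilated by `p 2` and `p 3` whose diagonal is a prescribed `D : Fin 3 → R`
(`exists_conj_diag`).

This is done by an Eilenberg swindle. Let `t` be the sum of the entries of `D` minus the scalar
`e₁ + e₂`, and let `f` be the infinite amplification `t ⊕ t ⊕ ⋯`, which satisfies `f ≅ f ⊕ t`
(`exists_swindle`). Consider
```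
      e₁ + e₂ - f   1   1
  M =      x        f   0
           v        0   t
```
where the column `(x, v)` is an isomorphism intertwining `f` with `f ⊕ t`. The diagonal of `M` has
the same sum as `D`, so the two entries `1` allow a unipotent lower triangular conjugation to
replace the diagonal of `M` by `D`. On the other hand, grouping the last two coordinates, the
invertible column allows a unipotent upper triangular conjugation to make the lower right corner of
`M` equal to `e₁`; since `f ≅ f ⊕ t`, the upper left corner becomes `e₂`. The matrix so obtained
has scalar diagonal `(e₂, e₁, e₁)` and zeros outside its first row, its first column and
its diagonal. For suitable `e₁` and `e₂` it is a sum of two block triangular matrices, each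
annihilated by the product of two of the linear factors of `p 2` or `p 3`.
-/

/-! ### A matrix with prescribed diagonal, similar to one with scalar diagonal -/

/-- A matrix with arbitrary prescribed diagonal `D` which is similar to one with scalar diagonal
`(e₂, e₁, e₁)`. The hypotheses say that the column `(x, v)` is invertible with inverse the row
`(x', v')`, and that it conjugates `f` into `diag(f, t)`. -/
theorem exists_conj_diag {R : Type*} [Ring R] [Algebra ℂ R] (D : Fin 3 → R) (e₁ e₂ : ℂ)
    {x x' v v' f t : R}
    (hxx : x * x' = 1) (hvv : v * v' = 1) (hxv : x * v' = 0) (hvx : v * x' = 0)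
    (h1 : x' * x + v' * v = 1) (hf : x' * f * x + v' * t * v = f)
    (ht : t = D 0 + D 1 + D 2 - (e₁ + e₂) • (1 : R)) :
    ∃ (P Q : Matrix (Fin 3) (Fin 3) R) (q₁ q₂ : R), P * Q = 1 ∧ Q * P = 1 ∧
      ∀ i, (P * !![e₂ • 1, q₁, q₂; x, e₁ • 1, 0; v, 0, e₁ • 1] * Q) i i = D i := by
  -- `(Z₁, Z₂) = (x', v') * (diag(f, t) - e₁)`, so that `(x, v) * (Z₁, Z₂) = diag(f, t) - e₁`.
  obtain ⟨Z₁, hZ₁⟩ : ∃ Z, Z = x' * (f - e₁ • 1) := ⟨_, rfl⟩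
  obtain ⟨Z₂, hZ₂⟩ : ∃ Z, Z = v' * (t - e₁ • 1) := ⟨_, rfl⟩
  have a1 : x * Z₁ = f - e₁ • 1 := by rw [hZ₁, ← mul_assoc, hxx, one_mul]
  have a2 : x * Z₂ = 0 := by rw [hZ₂, ← mul_assoc, hxv, zero_mul]
  have a3 : v * Z₂ = t - e₁ • 1 := by rw [hZ₂, ← mul_assoc, hvv, one_mul]
  have a4 : v * Z₁ = 0 := by rw [hZ₁, ← mul_assoc, hvx, zero_mul]
  have a5 : Z₁ * x + Z₂ * v = f - e₁ • 1 := by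
    have : Z₁ * x + Z₂ * v = (x' * f * x + v' * t * v) - e₁ • (x' * x + v' * v) := by
      rw [hZ₁, hZ₂]
      simp only [mul_sub, sub_mul, mul_smul_comm, smul_mul_assoc, mul_one, smul_add]
      abel
    rw [this, hf, h1]
  obtain ⟨G, hG⟩ : ∃ G, G = (e₁ + e₂) • (1 : R) - f := ⟨_, rfl⟩
  have hGe : e₂ • 1 = G + (Z₁ * x + Z₂ * v) := by rw [a5, hG, add_smul]; abel
  obtain ⟨h, hh⟩ : ∃ h : Matrix (Fin 3) (Fin 3) R, h = !![1, -Z₁, -Z₂; 0, 1, 0; 0, 0, 1] := ⟨_, rfl⟩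
  obtain ⟨h', hh'⟩ : ∃ h : Matrix (Fin 3) (Fin 3) R, h = !![1, Z₁, Z₂; 0, 1, 0; 0, 0, 1] := ⟨_, rfl⟩
  -- `g` moves `f - D 1` and `t - D 2` from the last two diagonal entries of `M` to the first.
  obtain ⟨z, hz⟩ : ∃ z, z = D 1 - f := ⟨_, rfl⟩
  obtain ⟨w, hw⟩ : ∃ w, w = D 2 - t := ⟨_, rfl⟩
  obtain ⟨g, hg⟩ : ∃ g : Matrix (Fin 3) (Fin 3) R, g = !![1, 0, 0; z, 1, 0; w, 0, 1] := ⟨_, rfl⟩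
  obtain ⟨g', hg'⟩ : ∃ g : Matrix (Fin 3) (Fin 3) R, g = !![1, 0, 0; -z, 1, 0; -w, 0, 1] :=
    ⟨_, rfl⟩
  have hhh : h * h' = 1 := by
    rw [hh, hh', Matrix.mul_fin_three, Matrix.one_fin_three]; simp
  have hhh' : h' * h = 1 := by
    rw [hh, hh', Matrix.mul_fin_three, Matrix.one_fin_three]; simp
  have hgg : g * g' = 1 := by
    rw [hg, hg', Matrix.mul_fin_three, Matrix.one_fin_three]; simp
  have hgg' : g' * g = 1 := by
    rw [hg, hg', Matrix.mul_fin_three, Matrix.one_fin_three]; simp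
  -- The free entries in the first row of `E` are chosen so that `M` has first row `(G, 1, 1)`.
  obtain ⟨E, hE⟩ : ∃ E, E = !![e₂ • (1 : R), 1 + e₁ • Z₁ - G * Z₁, 1 + e₁ • Z₂ - G * Z₂;
    x, e₁ • 1, 0; v, 0, e₁ • 1] := ⟨_, rfl⟩
  obtain ⟨M, hM⟩ : ∃ M, M = !![G, 1, 1; x, f, 0; v, 0, t] := ⟨_, rfl⟩
  have hEM : h * E = M * h := by
    rw [hE, hM, hh, Matrix.mul_fin_three, Matrix.mul_fin_three]
    simp only [hGe, one_mul, zero_mul, mul_zero, mul_one, neg_mul, mul_neg, a1, a2, a3, a4,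
      mul_smul_comm, smul_zero]
    ext i j
    fin_cases i <;> fin_cases j <;> simp <;> abel
  refine ⟨g * h, h' * g', 1 + e₁ • Z₁ - G * Z₁, 1 + e₁ • Z₂ - G * Z₂, ?_, ?_, ?_⟩
  · rw [mul_assoc, ← mul_assoc h, hhh, one_mul, hgg]
  · rw [mul_assoc, ← mul_assoc g', hgg', one_mul, hhh']
  · have key : g * h * E * (h' * g') = g * M * g' := by
      rw [mul_assoc g, hEM, mul_assoc, mul_assoc M, ← mul_assoc h, hhh, one_mul, mul_assoc]
    intro i
    rw [← hE, key, hM, hg, hg', Matrix.mul_fin_three, Matrix.mul_fin_three]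
    fin_cases i
    · simp [hG, hz, hw, ht]; abel
    · simp [hz]
    · simp [hw]

/-! ### Operators annihilated by cubic polynomials -/

theorem upperTriangular_sub_mul_eq_zero {R : Type*} [Ring R] [Algebra ℂ R] (r : Fin 3 → ℂ)
    (a b c : R) :
    (!![r 0 • 1, a, b; 0, r 1 • 1, c; 0, 0, r 2 • 1] - r 0 • (1 : Matrix (Fin 3) (Fin 3) R)) *
    (!![r 0 • 1, a, b; 0, r 1 • 1, c; 0, 0, r 2 • 1] - r 1 • 1) *
    (!![r 0 • 1, a, b; 0, r 1 • 1, c; 0, 0, r 2 • 1] - r 2 • 1) = 0 := by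
  ext i j
  fin_cases i <;> fin_cases j <;>
    simp [Matrix.mul_apply, Fin.sum_univ_three, Matrix.one_apply, mul_sub, sub_mul,
      -smul_eq_zero] <;> module

/-- The diagonal is in reverse order so that the factors occur in the order `r 0`, `r 1`, `r 2`. -/
theorem lowerTriangular_sub_mul_eq_zero {R : Type*} [Ring R] [Algebra ℂ R] (r : Fin 3 → ℂ)
    (a b c : R) :
    (!![r 2 • 1, 0, 0; a, r 1 • 1, 0; b, c, r 0 • 1] - r 0 • (1 : Matrix (Fin 3) (Fin 3) R)) *
    (!![r 2 • 1, 0, 0; a, r 1 • 1, 0; b, c, r 0 • 1] - r 1 • 1) *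
    (!![r 2 • 1, 0, 0; a, r 1 • 1, 0; b, c, r 0 • 1] - r 2 • 1) = 0 := by
  ext i j
  fin_cases i <;> fin_cases j <;>
    simp [Matrix.mul_apply, Fin.sum_univ_three, Matrix.one_apply, mul_sub, sub_mul,
      -smul_eq_zero] <;> module

theorem firstRow_sub_mul_eq_zero {R : Type*} [Ring R] [Algebra ℂ R] (ρ σ : ℂ) (a b : R) :
    (!![ρ • 1, a, b; 0, σ • 1, 0; 0, 0, σ • 1] - ρ • (1 : Matrix (Fin 3) (Fin 3) R)) *
    (!![ρ • 1, a, b; 0, σ • 1, 0; 0, 0, σ • 1] - σ • 1) = 0 := by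
  ext i j
  fin_cases i <;> fin_cases j <;>
    simp [Matrix.mul_apply, Fin.sum_univ_three, Matrix.one_apply]

theorem firstColumn_sub_mul_eq_zero {R : Type*} [Ring R] [Algebra ℂ R] (ρ σ : ℂ) (a b : R) :
    (!![ρ • 1, 0, 0; a, σ • 1, 0; b, 0, σ • 1] - σ • (1 : Matrix (Fin 3) (Fin 3) R)) *
    (!![ρ • 1, 0, 0; a, σ • 1, 0; b, 0, σ • 1] - ρ • 1) = 0 := by
  ext i j
  fin_cases i <;> fin_cases j <;>
    simp [Matrix.mul_apply, Fin.sum_univ_three, Matrix.one_apply]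

theorem aeval_eq_zero_of_roots {A : Type*} [Ring A] [Algebra ℂ A] {a : ℂ} {r : Fin 3 → ℂ}
    {p : Polynomial ℂ} (hp : p = .C a * ((.X - .C (r 0)) * (.X - .C (r 1)) * (.X - .C (r 2))))
    {M : A} (hM : (M - r 0 • (1 : A)) * (M - r 1 • 1) * (M - r 2 • 1) = 0) :
    Polynomial.aeval M p = 0 := by
  simp only [← Algebra.algebraMap_eq_smul_one] at hM
  simp [hp, hM]

theorem exists_roots {p : Polynomial ℂ} (hp : p.degree = 3) :
    ∃ (a : ℂ) (r : Fin 3 → ℂ),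
      p = .C a * ((.X - .C (r 0)) * (.X - .C (r 1)) * (.X - .C (r 2))) := by
  have hs := IsAlgClosed.splits p
  have hc : p.roots.card = 3 := by
    rw [← hs.natDegree_eq_card_roots]
    exact Polynomial.natDegree_eq_of_degree_eq_some hp
  obtain ⟨x, y, z, h⟩ := Multiset.card_eq_three.1 hc
  refine ⟨p.leadingCoeff, ![x, y, z], ?_⟩
  conv_lhs => rw [hs.eq_prod_roots]
  simp [h, mul_assoc]

theorem aeval_conj_eq_zero {A : Type*} [Ring A] [Algebra ℂ A] {P Q M : A} (hPQ : P * Q = 1)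
    (hQP : Q * P = 1) {p : Polynomial ℂ} (hM : Polynomial.aeval M p = 0) :
    Polynomial.aeval (P * M * Q) p = 0 := by
  suffices h : Polynomial.aeval (P * M * Q) p = P * Polynomial.aeval M p * Q by
    rw [h, hM, mul_zero, zero_mul]
  clear hM
  induction p using Polynomial.induction_on' with
  | add p q hp hq => simp only [map_add, hp, hq, mul_add, add_mul]
  | monomial n c =>
    have : (P * M * Q) ^ n = P * M ^ n * Q := Units.conj_pow ⟨P, Q, hPQ, hQP⟩ M n
    simp [Polynomial.aeval_monomial, this, ← Algebra.smul_def]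

/-! ### Hilbert sums of copies of a Hilbert space -/

section

variable {H : Type*} [NormedAddCommGroup H] [InnerProductSpace ℂ H] [CompleteSpace H]

omit [CompleteSpace H] in
theorem HilbertBasis.clm_ext {ι : Type*} (b : HilbertBasis ι ℂ H) {F : Type*}
    [NormedAddCommGroup F] [NormedSpace ℂ F] {f g : H →L[ℂ] F} (h : ∀ i, f (b i) = g (b i)) :
    f = g := by
  refine ContinuousLinearMap.ext_on (s := Set.range b) ?_ ?_
  · exact Submodule.dense_iff_topologicalClosure_eq_top.2 b.dense_span
  · rintro _ ⟨i, rfl⟩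
    exact h i

theorem HilbertBasis.exists_linearIsometry {ι : Type*} (b : HilbertBasis ι ℂ H) {σ : ι → ι}
    (hσ : σ.Injective) : ∃ V : H →ₗᵢ[ℂ] H, ∀ i, V (b i) = b (σ i) := by
  classical
  have ho : Orthonormal ℂ (fun i ↦ b (σ i)) := b.orthonormal.comp σ hσ
  refine ⟨ho.orthogonalFamily.linearIsometry.comp b.repr.toLinearIsometry, fun i ↦ ?_⟩
  have := ho.orthogonalFamily.linearIsometry_apply_single (i := i) (1 : ℂ)
  rw [← b.repr_self] at this
  simpa using this

theorem exists_prod_equiv (κ : Type) [Countable κ] [Nonempty κ] (ι : Type*) [Infinite ι] :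
    Nonempty (κ × ι ≃ ι) := by
  rw [← Cardinal.eq, Cardinal.mk_prod, Cardinal.lift_uzero]
  refine Cardinal.mul_eq_right (Cardinal.aleph0_le_mk ι) ?_ (by simp)
  exact (Cardinal.lift_le_aleph0.2 (Cardinal.mk_le_aleph0)).trans (Cardinal.aleph0_le_mk ι)

/-- An infinite-dimensional Hilbert space is the Hilbert sum of countably many copies of itself. -/
theorem exists_isHilbertSum (hH : ¬ FiniteDimensional ℂ H) (κ : Type) [Countable κ] [Nonempty κ] :
    ∃ V : κ → H →ₗᵢ[ℂ] H, IsHilbertSum ℂ (fun _ ↦ H) V := by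
  obtain ⟨ι, b, -⟩ := exists_hilbertBasis ℂ H
  have : Infinite ι := by
    by_contra h
    have := not_infinite_iff_finite.1 h
    have := Fintype.ofFinite ι
    exact hH b.toOrthonormalBasis.toBasis.finiteDimensional_of_finite
  obtain ⟨e⟩ := exists_prod_equiv κ ι
  choose V hV using fun k ↦ b.exists_linearIsometry
    (σ := fun i ↦ e (k, i)) (fun i j h ↦ by simpa using h)
  refine ⟨V, .mk (fun k l hkl x y ↦ ?_) ?_⟩
  · have key : innerSL ℂ (V k x) ∘L (V l).toContinuousLinearMap = 0 := by
      refine b.clm_ext fun j ↦ ?_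
      have : innerSL ℂ (V l (b j)) ∘L (V k).toContinuousLinearMap = 0 := by
        refine b.clm_ext fun i ↦ ?_
        simpa [hV] using b.orthonormal.2 (by simp [hkl.symm])
      simpa [inner_eq_zero_symm] using congr($this x)
    simpa using congr($key y)
  · rw [← b.dense_span]
    refine Submodule.topologicalClosure_mono (Submodule.span_le.2 ?_)
    rintro _ ⟨i, rfl⟩
    refine (le_iSup (fun k ↦ (V k).toLinearMap.range) (e.symm i).1) ⟨b (e.symm i).2, ?_⟩
    simp [hV]

theorem IsHilbertSum.clm_ext {κ : Type*} {V : κ → H →ₗᵢ[ℂ] H} (hV : IsHilbertSum ℂ (fun _ ↦ H) V)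
    {F : Type*} [NormedAddCommGroup F] [NormedSpace ℂ F] {f g : H →L[ℂ] F}
    (h : ∀ k x, f (V k x) = g (V k x)) : f = g := by
  classical
  have : f ∘L (hV.linearIsometryEquiv.symm : lp (fun _ : κ ↦ H) 2 →L[ℂ] H) =
      g ∘L (hV.linearIsometryEquiv.symm : lp (fun _ : κ ↦ H) 2 →L[ℂ] H) := by
    refine lp.ext_continuousLinearMap (by simp) fun k ↦ ?_
    ext x
    simpa [hV.linearIsometryEquiv_symm_apply_single] using h k x
  ext x
  simpa using congr($this (hV.linearIsometryEquiv x))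

theorem IsHilbertSum.linearIsometryEquiv_apply {κ : Type*} [DecidableEq κ] {V : κ → H →ₗᵢ[ℂ] H}
    (hV : IsHilbertSum ℂ (fun _ ↦ H) V) (k : κ) (x : H) :
    hV.linearIsometryEquiv (V k x) = lp.single 2 k x := by
  rw [← hV.linearIsometryEquiv_symm_apply_single x, LinearIsometryEquiv.apply_symm_apply]

/-- The amplification of `t`: the operator acting as `t` on each summand. -/
theorem IsHilbertSum.exists_amplification {κ : Type*} {V : κ → H →ₗᵢ[ℂ] H}
    (hV : IsHilbertSum ℂ (fun _ ↦ H) V) (t : H →L[ℂ] H) :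
    ∃ f : H →L[ℂ] H, ∀ k x, f (V k x) = V k (t x) := by
  classical
  refine ⟨(hV.linearIsometryEquiv.symm.toContinuousLinearEquiv : _ →L[ℂ] H) ∘L
    lp.mapCLM 2 (fun _ ↦ t) (norm_nonneg t) (fun _ ↦ le_rfl) ∘L
    (hV.linearIsometryEquiv.toContinuousLinearEquiv : H →L[ℂ] lp (fun _ : κ ↦ H) 2), fun k x ↦ ?_⟩
  have h2 : lp.mapCLM 2 (fun _ ↦ t) (norm_nonneg t) (fun _ ↦ le_rfl)
      (lp.single (E := fun _ : κ ↦ H) 2 k x) = lp.single (E := fun _ : κ ↦ H) 2 k (t x) := by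
    ext i
    by_cases hi : i = k
    · subst hi; simp [lp.mapCLM]
    · simp [lp.mapCLM, hi]
  simp [hV.linearIsometryEquiv_apply, h2, hV.linearIsometryEquiv_symm_apply_single]

theorem IsHilbertSum.exists_shift {V : ℕ → H →ₗᵢ[ℂ] H} (hV : IsHilbertSum ℂ (fun _ ↦ H) V) :
    ∃ S : H →ₗᵢ[ℂ] H, ∀ k x, S (V k x) = V (k + 1) x := by
  classical
  have ho : OrthogonalFamily ℂ (fun _ : ℕ ↦ H) fun n ↦ V (n + 1) :=
    hV.OrthogonalFamily.comp (add_left_injective 1)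
  refine ⟨ho.linearIsometry.comp hV.linearIsometryEquiv.toLinearIsometry, fun k x ↦ ?_⟩
  simp [hV.linearIsometryEquiv_apply]

open ContinuousLinearMap in
theorem IsHilbertSum.adjoint_mul {κ : Type*} {V : κ → H →ₗᵢ[ℂ] H}
    (hV : IsHilbertSum ℂ (fun _ ↦ H) V) [DecidableEq κ] (k l : κ) :
    adjoint (V k).toContinuousLinearMap * (V l).toContinuousLinearMap = if k = l then 1 else 0 := by
  split_ifs with h
  · subst h; exact (V k).adjoint_comp_self
  · ext x
    refine ext_inner_left ℂ fun y ↦ ?_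
    simpa [adjoint_inner_right] using hV.OrthogonalFamily h y x

open ContinuousLinearMap in
/-- Every operator `t` has an `f` with `f ≅ f ⊕ t`, namely its amplification `t ⊕ t ⊕ ⋯`. Here `x'`
is the shift of the summands, `v'` the inclusion of the first one, and `x`, `v` are the adjoints. -/
theorem exists_swindle (hH : ¬ FiniteDimensional ℂ H) (t : H →L[ℂ] H) :
    ∃ x x' v v' f : H →L[ℂ] H, x * x' = 1 ∧ v * v' = 1 ∧ x * v' = 0 ∧ v * x' = 0 ∧
      x' * x + v' * v = 1 ∧ x' * f * x + v' * t * v = f := by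
  obtain ⟨V, hV⟩ := exists_isHilbertSum hH ℕ
  obtain ⟨f, hf⟩ := hV.exists_amplification t
  obtain ⟨S, hS⟩ := hV.exists_shift
  set s := S.toContinuousLinearMap
  set v := (V 0).toContinuousLinearMap
  have hss : adjoint s * s = 1 := S.adjoint_comp_self
  have hvs : adjoint v * s = 0 := hV.clm_ext fun k x ↦ by
    simpa [s, v, hS] using congr($(hV.adjoint_mul 0 (k + 1)) x)
  have hsv : adjoint s * v = 0 := by
    simpa [← star_eq_adjoint] using congr(star $hvs)
  have hvv : adjoint v * v = 1 := (V 0).adjoint_comp_self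
  have h0 (x) : adjoint s (V 0 x) = 0 := congr($hsv x)
  have h0' (x) : adjoint v (V 0 x) = x := congr($hvv x)
  have h1 (k x) : adjoint s (V (k + 1) x) = V k x := by
    rw [← hS]; exact congr($hss (V k x))
  have h1' (k x) : adjoint v (V (k + 1) x) = 0 := by
    rw [← hS]; exact congr($hvs (V k x))
  refine ⟨adjoint s, s, adjoint v, v, f, hss, hvv, hsv, hvs, hV.clm_ext fun k x ↦ ?_,
    hV.clm_ext fun k x ↦ ?_⟩
  · cases k <;> simp [h0, h0', h1, h1', s, v, hS]
  · cases k <;> simp [h0, h0', h1, h1', s, v, hS, hf]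

end

/-! ### Reduction to matrices -/

/-- Elements `S k` with orthogonal left inverses `S' k` and `∑ k, S k * S' k = 1` identifies `A`
with a matrix algebra over itself, through `M ↦ ∑ i, ∑ j, S i * M i j * S' j`. -/
theorem exists_algHom_matrix_surjective {A κ : Type*} [Ring A] [Algebra ℂ A] [Fintype κ]
    [DecidableEq κ] {S S' : κ → A}
    (h : ∀ k l, S' k * S l = if k = l then 1 else 0) (h1 : ∑ k, S k * S' k = 1) :
    ∃ Ψ : Matrix κ κ A →ₐ[ℂ] A, Function.Surjective Ψ := by
  refine ⟨AlgHom.ofLinearMap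
    { toFun M := ∑ i, ∑ j, S i * M i j * S' j
      map_add' M N := by simp [mul_add, add_mul, Finset.sum_add_distrib]
      map_smul' c M := by simp [Finset.smul_sum] } ?_ ?_, fun B ↦ ⟨.of fun i j ↦ S' i * B * S j, ?_⟩⟩
  · simpa [Matrix.one_apply] using h1
  · intro M N
    have (i j k l : κ) : S i * M i j * S' j * (S k * N k l * S' l) =
        if j = k then S i * (M i j * N k l) * S' l else 0 := by
      rw [show S i * M i j * S' j * (S k * N k l * S' l) =
        S i * M i j * (S' j * S k) * N k l * S' l by simp only [mul_assoc], h]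
      split_ifs <;> simp [mul_assoc]
    simp [Matrix.mul_apply, Finset.mul_sum, Finset.sum_mul, this]
    refine (Finset.sum_comm.trans (Finset.sum_congr rfl fun l _ ↦ ?_)).trans Finset.sum_comm
    exact Finset.sum_comm
  · have : ∀ i j, S i * (S' i * B * S j) * S' j = (S i * S' i) * B * (S j * S' j) := by
      intros; simp only [mul_assoc]
    simp only [AlgHom.ofLinearMap_apply, LinearMap.coe_mk, AddHom.coe_mk, Matrix.of_apply, this,
      ← Finset.mul_sum, ← Finset.sum_mul, h1, one_mul, mul_one]

/-- The decomposition for `3 × 3` matrices over an algebra that allows the swindle. -/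
theorem Matrix.exists_sum_aeval_eq_zero {R : Type*} [Ring R] [Algebra ℂ R]
    (hR : ∀ t : R, ∃ x x' v v' f : R, x * x' = 1 ∧ v * v' = 1 ∧ x * v' = 0 ∧ v * x' = 0 ∧
      x' * x + v' * v = 1 ∧ x' * f * x + v' * t * v = f)
    {p : Fin 4 → Polynomial ℂ} (hp : ∀ i, (p i).degree = 3) (B : Matrix (Fin 3) (Fin 3) R) :
    ∃ C : Fin 4 → Matrix (Fin 3) (Fin 3) R,
      B = ∑ i, C i ∧ ∀ i, Polynomial.aeval (C i) (p i) = 0 := by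
  choose a r hr using fun i ↦ exists_roots (hp i)
  -- The first two summands have diagonals `r 0` and, in reverse order, `r 1`.
  obtain ⟨D, hD⟩ : ∃ D : Fin 3 → R, D = fun i ↦ B i i - (r 0 i + r 1 (2 - i)) • 1 := ⟨_, rfl⟩
  obtain ⟨x, x', v, v', f, hxx, hvv, hxv, hvx, h1, hf⟩ := hR (D 0 + D 1 + D 2 -
    ((r 2 1 + r 3 0) + (r 2 0 + r 3 1)) • (1 : R))
  obtain ⟨P, Q, q₁, q₂, hPQ, hQP, hS⟩ := exists_conj_diag D _ _ hxx hvv hxv hvx h1 hf rfl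
  obtain ⟨T, hT⟩ : ∃ T, T = B - P * !![(r 2 0 + r 3 1) • 1, q₁, q₂; x, (r 2 1 + r 3 0) • 1, 0;
    v, 0, (r 2 1 + r 3 0) • 1] * Q := ⟨_, rfl⟩
  have hTd (i) : T i i = (r 0 i + r 1 (2 - i)) • 1 := by
    rw [hT, Matrix.sub_apply, hS, hD]; simp
  have hadd : !![(r 2 0 + r 3 1) • (1 : R), q₁, q₂; x, (r 2 1 + r 3 0) • 1, 0;
        v, 0, (r 2 1 + r 3 0) • 1] =
      !![r 2 0 • 1, q₁, q₂; 0, r 2 1 • 1, 0; 0, 0, r 2 1 • 1] +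
      !![r 3 1 • 1, 0, 0; x, r 3 0 • 1, 0; v, 0, r 3 0 • 1] := by
    ext i j
    fin_cases i <;> fin_cases j <;> simp [add_smul]
  have hTadd : T = !![r 0 0 • 1, T 0 1, T 0 2; 0, r 0 1 • 1, T 1 2; 0, 0, r 0 2 • 1] +
      !![r 1 2 • 1, 0, 0; T 1 0, r 1 1 • 1, 0; T 2 0, T 2 1, r 1 0 • 1] := by
    ext i j
    fin_cases i <;> fin_cases j <;> simp [add_smul, hTd]
  refine ⟨![!![r 0 0 • 1, T 0 1, T 0 2; 0, r 0 1 • 1, T 1 2; 0, 0, r 0 2 • 1],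
    !![r 1 2 • 1, 0, 0; T 1 0, r 1 1 • 1, 0; T 2 0, T 2 1, r 1 0 • 1],
    P * !![r 2 0 • 1, q₁, q₂; 0, r 2 1 • 1, 0; 0, 0, r 2 1 • 1] * Q,
    P * !![r 3 1 • 1, 0, 0; x, r 3 0 • 1, 0; v, 0, r 3 0 • 1] * Q], ?_, fun i ↦ ?_⟩
  · have : B = T + P * !![(r 2 0 + r 3 1) • 1, q₁, q₂; x, (r 2 1 + r 3 0) • 1, 0;
      v, 0, (r 2 1 + r 3 0) • 1] * Q := by rw [hT, sub_add_cancel]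
    rw [Fin.sum_univ_four, this, hadd, mul_add, add_mul, ← add_assoc]
    nth_rw 1 [hTadd]
    rfl
  · fin_cases i
    · exact aeval_eq_zero_of_roots (hr 0) (upperTriangular_sub_mul_eq_zero _ _ _ _)
    · exact aeval_eq_zero_of_roots (hr 1) (lowerTriangular_sub_mul_eq_zero _ _ _ _)
    · refine aeval_conj_eq_zero hPQ hQP (aeval_eq_zero_of_roots (hr 2) ?_)
      rw [firstRow_sub_mul_eq_zero, zero_mul]
    · refine aeval_conj_eq_zero hPQ hQP (aeval_eq_zero_of_roots (hr 3) ?_)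
      rw [firstColumn_sub_mul_eq_zero, zero_mul]

open ContinuousLinearMap in
theorem exists_matrix_algHom_surjective {H : Type*} [NormedAddCommGroup H]
    [InnerProductSpace ℂ H] [CompleteSpace H] (hH : ¬ FiniteDimensional ℂ H) :
    ∃ Ψ : Matrix (Fin 3) (Fin 3) (H →L[ℂ] H) →ₐ[ℂ] (H →L[ℂ] H), Function.Surjective Ψ := by
  obtain ⟨V, hV⟩ := exists_isHilbertSum hH (Fin 3)
  refine exists_algHom_matrix_surjective (S := fun k ↦ (V k).toContinuousLinearMap) hV.adjoint_mul
    (hV.clm_ext fun l x ↦ ?_)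
  have key (k : Fin 3) : adjoint (V k).toContinuousLinearMap (V l x) = if k = l then x else 0 := by
    have := congr($(hV.adjoint_mul k l) x)
    split_ifs at this ⊢ <;> exact this
  simp [key, apply_ite]

theorem proposition3p1 {H : Type*} [NormedAddCommGroup H] [InnerProductSpace ℂ H]
    [CompleteSpace H] (hH : ¬ FiniteDimensional ℂ H)
    (p : Fin 4 → Polynomial ℂ) (hp : ∀ i, (p i).degree = 3) (B : H →L[ℂ] H) :
    ∃ C : Fin 4 → (H →L[ℂ] H),
      B = ∑ i, C i ∧ ∀ i, Polynomial.aeval (C i) (p i) = 0 := by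
  obtain ⟨Ψ, hΨ⟩ := exists_matrix_algHom_surjective hH
  obtain ⟨B, rfl⟩ := hΨ B
  obtain ⟨C, rfl, hC⟩ := Matrix.exists_sum_aeval_eq_zero (exists_swindle hH) hp B
  exact ⟨fun i ↦ Ψ (C i), map_sum .., fun i ↦ by rw [Polynomial.aeval_algHom_apply, hC, map_zero]⟩
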